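/- A gyrogroup is a set $G$ with a binary operation $\oplus$, a two-sided identity $0$, two-sided inverses $\ominus x$, and automorphisms $\mathrm{gyr}[x,y]$ of $(G,\oplus)$ such that $x\oplus(y\oplus z)=(x\oplus y)\oplus \mathrm{gyr}[x,y](z)$ and $\mathrm{gyr}[x\oplus y,y]=\mathrm{gyr}[x,y]$ for all $x,y,z\in G$. It is a topological gyrogroup if it carries a topology for which $\oplus$ is jointly continuous and $\ominus$ is continuous. A strongly topological gyrogroup with a symmetric neighborhood base $\mathscr U$ at $0$ is a topological gyrogroup with a neighborhood base $\mathscr U$ at $0$ such that $\ominus U=U$ and $\mathrm{gyr}[x,y](U)=U$ for all $U\in\mathscr U$ and $x,y\in G$. A subgyrogroup of $G$ is a nonempty subset $H$ that is a gyrogroup under the inherited operation and is mapped onto itself by $\mathrm{gyr}[a,b]$ for all $a,b\in H$. A subgyrogroup $H$ is admissible and generated from $\mathscr U$ if there are open symmetric neighborhoods $U_n\in\mathscr U$ of $0$ $(n\in\omega)$ with $U_{n+1}\oplus(U_{n+1}\oplus U_{n+1})\subset U_n$ for all $n$ and $H=\bigcap_{n\in\omega}U_n$. The coset space $G/H=\{a\oplus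 H: a\in G\}$ carries the quotient topology of the map $a\mapsto a\oplus H$. A family $\mathcal P$ of subsets of a space $X$ is a $k$-network if whenever $K\subset U$ with $K$ compact and $U$ open in $X$, there is a finite $\mathcal P'\subset\mathcal P$ with $K\subset\bigcup\mathcal P'\subset U$; it is star-countable if every member of $\mathcal P$ meets at most countably many members of $\mathcal P$. **Theorem.** Let $G$ be a Hausdorff strongly topological gyrogroup with a symmetric neighborhood base $\mathscr U$ at $0$, and let $H$ be an admissible subgyrogroup of $G$ generated from $\mathscr U$ that is second-countable in the subspace topology. If the quotient space $G/H$ has a star-countable $k$-network, then $G$ has a star-countable $k$-network. -/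

import Mathlib

open Set Topology
open scoped Pointwise

/-- A gyrogroup, written additively: `x + y` is `x ⊕ y` and `-x` is `⊖ x`. The identity, the
inverses and the gyrations are unique (see the lemmas below), so recording them as data
adds nothing to the mere existence of these objects. -/
class Gyrogroup (G : Type*) extends AddZeroClass G, Neg G where
  neg_add_self : ∀ x : G, -x + x = 0
  add_neg_self : ∀ x : G, x + -x = 0
  /-- The gyration `gyr x y`, an automorphism of `(G, +)`. -/
  gyr : G → G → G ≃+ G
  add_gyr : ∀ x y z : G, x + (y + z) = (x + y) + gyr x y z
  gyr_loop : ∀ x y : G, gyr (x + y) y = gyr x y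

namespace Gyrogroup

section Basic

variable {G : Type*} [Gyrogroup G]

theorem zero_unique (e : G) (h : ∀ a : G, e + a = a ∧ a + e = a) : e = 0 := by
  have := (h 0).1
  rwa [add_zero] at this

theorem add_left_inj' {x y z : G} (h : x + y = x + z) : y = z := by
  have h1 : -x + (x + y) = -x + (x + z) := by rw [h]
  rw [add_gyr, add_gyr, neg_add_self, zero_add, zero_add] at h1
  exact (gyr (-x) x).injective h1

theorem neg_unique {x y : G} (h : x + y = 0) : y = -x :=
  add_left_inj' (h.trans (add_neg_self x).symm)

theorem gyr_unique {x y : G} {f : G → G} (h : ∀ z, x + (y + z) = (x + y) + f z) (z : G) :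
    f z = gyr x y z :=
  add_left_inj' ((h z).symm.trans (add_gyr x y z))

/-- A nonempty subset closed under the operations such that every `gyr a b` with `a, b ∈ H`
restricts to an automorphism of `H`. With the inherited operation `H` is then a gyrogroup
(`IsSubgyrogroup.toGyrogroup`). -/
structure IsSubgyrogroup (H : Set G) : Prop where
  nonempty : H.Nonempty
  add_mem : ∀ a ∈ H, ∀ b ∈ H, a + b ∈ H
  neg_mem : ∀ a ∈ H, -a ∈ H
  gyr_image : ∀ a ∈ H, ∀ b ∈ H, gyr a b '' H = H

theorem IsSubgyrogroup.zero_mem {H : Set G} (hH : IsSubgyrogroup H) : (0 : G) ∈ H := by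
  obtain ⟨a, ha⟩ := hH.nonempty
  have := hH.add_mem _ (hH.neg_mem a ha) _ ha
  rwa [neg_add_self] at this

/-- The gyrogroup structure inherited by a subgyrogroup. -/
@[reducible] noncomputable def IsSubgyrogroup.toGyrogroup {H : Set G} (hH : IsSubgyrogroup H) :
    Gyrogroup H where
  add a b := ⟨a + b, hH.add_mem _ a.2 _ b.2⟩
  zero := ⟨0, hH.zero_mem⟩
  neg a := ⟨-a, hH.neg_mem _ a.2⟩
  zero_add a := Subtype.ext (zero_add (a : G))
  add_zero a := Subtype.ext (add_zero (a : G))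
  neg_add_self a := Subtype.ext (neg_add_self (a : G))
  add_neg_self a := Subtype.ext (add_neg_self (a : G))
  gyr a b :=
    letI : Add H := ⟨fun a b => ⟨a + b, hH.add_mem _ a.2 _ b.2⟩⟩
    { (gyr (a : G) (b : G)).toEquiv.image H |>.trans
        (Equiv.setCongr (hH.gyr_image _ a.2 _ b.2)) with
      map_add' := fun x y => Subtype.ext (map_add (gyr (a : G) (b : G)) (x : G) (y : G)) }
  add_gyr a b c := Subtype.ext (add_gyr (a : G) (b : G) (c : G))
  gyr_loop a b := by
    refine DFunLike.ext _ _ fun c => Subtype.ext ?_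
    exact congrArg (fun f : G ≃+ G => f (c : G)) (gyr_loop (a : G) (b : G))

/-- The set `G/H = {a ⊕ H : a ∈ G}` of left cosets. -/
def CosetSpace (H : Set G) : Type _ :=
  {C : Set G // ∃ a : G, C = (fun h => a + h) '' H}

/-- The natural map `a ↦ a ⊕ H`. -/
def CosetSpace.mk (H : Set G) (a : G) : CosetSpace H :=
  ⟨(fun h => a + h) '' H, a, rfl⟩

end Basic

section Topological

variable {G : Type*} [TopologicalSpace G] [Gyrogroup G]

/-- The quotient topology: `O ⊆ G/H` is open iff its preimage in `G` is open. -/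
instance CosetSpace.instTopologicalSpace (H : Set G) : TopologicalSpace (CosetSpace H) :=
  TopologicalSpace.coinduced (CosetSpace.mk H) inferInstance

/-- A topological gyrogroup: `⊕` is jointly continuous and `⊖` is continuous. -/
class IsTopologicalGyrogroup (G : Type*) [TopologicalSpace G] [Gyrogroup G] : Prop
    extends ContinuousAdd G, ContinuousNeg G

/-- `𝒰` is a neighborhood base at `0` of symmetric sets that are invariant under all gyrations.
A topological gyrogroup together with such a `𝒰` is a strongly topological gyrogroup with
symmetric neighborhood base `𝒰` at `0`. -/
structure IsStrongSymmetricBase (𝒰 : Set (Set G)) : Prop where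
  hasBasis : (𝓝 (0 : G)).HasBasis (fun U => U ∈ 𝒰) id
  symmetric : ∀ U ∈ 𝒰, (fun x : G => -x) '' U = U
  gyr_image : ∀ U ∈ 𝒰, ∀ x y : G, gyr x y '' U = U

/-- `H` is an admissible subgyrogroup generated from `𝒰`. -/
structure IsAdmissibleFrom (𝒰 : Set (Set G)) (H : Set G) : Prop where
  isSubgyrogroup : IsSubgyrogroup H
  exists_seq : ∃ U : ℕ → Set G,
    (∀ n, U n ∈ 𝒰 ∧ IsOpen (U n) ∧ (0 : G) ∈ U n ∧ (fun x : G => -x) '' U n = U n) ∧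
    (∀ n, U (n + 1) + (U (n + 1) + U (n + 1)) ⊆ U n) ∧
    H = ⋂ n, U n

end Topological

end Gyrogroup

/-- A `k`-network: whenever `K ⊆ U` with `K` compact and `U` open, some finite subfamily `ℱ`
satisfies `K ⊆ ⋃ ℱ ⊆ U`. -/
def IsKNetwork {X : Type*} [TopologicalSpace X] (𝒜 : Set (Set X)) : Prop :=
  ∀ K U : Set X, IsCompact K → IsOpen U → K ⊆ U →
    ∃ ℱ : Set (Set X), ℱ ⊆ 𝒜 ∧ ℱ.Finite ∧ K ⊆ ⋃₀ ℱ ∧ ⋃₀ ℱ ⊆ U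

/-- A family is star-countable if each member meets only countably many members. -/
def IsStarCountable {X : Type*} (𝒜 : Set (Set X)) : Prop :=
  ∀ P ∈ 𝒜, {Q ∈ 𝒜 | (P ∩ Q).Nonempty}.Countable

/-- The space `X` has a star-countable `k`-network. -/
def HasStarCountableKNetwork (X : Type*) [TopologicalSpace X] : Prop :=
  ∃ 𝒜 : Set (Set X), IsStarCountable 𝒜 ∧ IsKNetwork 𝒜

/-!
Write `π = CosetSpace.mk H`. Since `H` is an intersection of gyration-invariant sets, it is itself
invariant under all gyrations; hence `π` is an open map and `π z = π n` means `z ∈ n + H`.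

Let `𝒬` be a star-countable `k`-network of `G/H`. For `P ∈ 𝒬` the countably many members of `𝒬`
that meet `P` form a network at the points of `P`; as the fibres of `π` are separable, `π ⁻¹' P`
has a countable dense subset `B P` (`exists_countable_dense_preimage_mk`). As `H` is first
countable, there are gyration-invariant neighborhoods `V i` of `0` in `G` such that every
neighborhood of `0` contains `(V i + V i) ∩ H` for some `i` (`exists_seq_invariant_nhds`). The `k`-network of `G` consists of the sets
`{z | π z ∈ P ∧ -b + z ∈ V i}` with `P ∈ 𝒬`, `b ∈ B P` and `i : ℕ`. Two of these meet only if the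
corresponding members of `𝒬` meet, so the family is star-countable.

For the `k`-network property let `x ∈ K ⊆ U`. Choose neighborhoods `N` of `x` and `O` of `0` with
`N + O ⊆ U`, then `i` with `(V i + V i) ∩ H ⊆ O`, and shrink `N` so that `-b + y ∈ V i` for all
`b, y ∈ N`. If `π z ∈ π '' N` and `-b + z ∈ V i` with `b ∈ N`, then `z = n + h` with `n ∈ N`,
`h ∈ H`, and `h = -n + z = (-n + b) + gyr (-n) b (-b + z)` lies in `V i + V i`, so `z ∈ U`
(`mem_of_mk_mem_image`). A compact neighborhood `C ⊆ N` of `x` in `K` is therefore covered by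
finitely many members inside `U`: finitely many `P ∈ 𝒬` inside `π '' N` cover `π '' C`, and for
each one that is met by `π '' C` there is a suitable `b` in `B P ∩ N`. Compactness of `K`
finishes the proof.
-/

namespace Gyrogroup

section Algebra

variable {G : Type*} [Gyrogroup G]

theorem gyr_zero_left (y z : G) : gyr 0 y z = z := by
  have h := add_gyr 0 y z
  rw [zero_add, zero_add] at h
  exact (add_left_inj' h).symm

theorem neg_add_cancel_left' (x y : G) : -x + (x + y) = y := by
  rw [add_gyr, ← gyr_loop, neg_add_self, gyr_zero_left, zero_add]

theorem add_neg_cancel_left' (x y : G) : x + (-x + y) = y := by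
  rw [add_gyr, ← gyr_loop, add_neg_self, gyr_zero_left, zero_add]

theorem exists_add_of_mk_eq {H : Set G} (h0 : (0 : G) ∈ H) {a b : G}
    (h : CosetSpace.mk H a = CosetSpace.mk H b) : ∃ k ∈ H, b + k = a := by
  have h1 : (fun k => a + k) '' H = (fun k => b + k) '' H := congrArg Subtype.val h
  have h2 : a ∈ (fun k => a + k) '' H := ⟨0, h0, add_zero a⟩
  rw [h1] at h2
  exact h2

theorem mk_add_eq {H : Set G} (hH : IsSubgyrogroup H) (hg : ∀ x y : G, gyr x y '' H = H)
    (y : G) {k : G} (hk : k ∈ H) : CosetSpace.mk H (y + k) = CosetSpace.mk H y := by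
  refine Subtype.ext (Subset.antisymm ?_ ?_)
  · rintro _ ⟨l, hl, rfl⟩
    obtain ⟨m, hm, rfl⟩ := (hg y k).symm ▸ hl
    exact ⟨k + m, hH.add_mem _ hk _ hm, add_gyr y k m⟩
  · rintro _ ⟨l, hl, rfl⟩
    refine ⟨gyr y k (-k + l), hg y k ▸
      mem_image_of_mem _ (hH.add_mem _ (hH.neg_mem _ hk) _ hl), ?_⟩
    simp only
    rw [← add_gyr, add_neg_cancel_left']

/-- A point lying over `π '' N` and in a translate `b + V` with `b ∈ N` differs from a point of `N`
by an element of `H` in `V + V`. -/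
theorem mem_of_mk_mem_image {H : Set G} (h0 : (0 : G) ∈ H) {V N O U : Set G}
    (hV : ∀ x y : G, gyr x y '' V = V) (hNV : ∀ b ∈ N, ∀ y ∈ N, -b + y ∈ V)
    (hVO : (V + V) ∩ H ⊆ O) (hNO : ∀ n ∈ N, ∀ h ∈ O, n + h ∈ U) {b z : G} (hb : b ∈ N)
    (hz : CosetSpace.mk H z ∈ CosetSpace.mk H '' N) (hbz : -b + z ∈ V) : z ∈ U := by
  obtain ⟨n, hn, hnz⟩ := hz
  obtain ⟨h, hh, rfl⟩ := exists_add_of_mk_eq h0 hnz.symm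
  refine hNO n hn h (hVO ⟨⟨-n + b, hNV n hn b hb, gyr (-n) b (-b + (n + h)), ?_, ?_⟩, hh⟩)
  · exact hV (-n) b ▸ mem_image_of_mem _ hbz
  · simp only
    rw [← add_gyr, add_neg_cancel_left', neg_add_cancel_left']

end Algebra

section Topological

variable {G : Type*} [TopologicalSpace G] [Gyrogroup G]

theorem IsAdmissibleFrom.gyr_image {𝒰 : Set (Set G)} (h𝒰 : IsStrongSymmetricBase 𝒰) {H : Set G}
    (hH : IsAdmissibleFrom 𝒰 H) (x y : G) : gyr x y '' H = H := by
  obtain ⟨U, hU, -, rfl⟩ := hH.exists_seq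
  rw [image_iInter (gyr x y).bijective]
  exact iInter_congr fun n => h𝒰.gyr_image _ (hU n).1 x y

theorem continuous_mk (H : Set G) : Continuous (CosetSpace.mk H) :=
  continuous_coinduced_rng

theorem isOpenMap_mk [IsTopologicalGyrogroup G] {H : Set G} (hH : IsSubgyrogroup H)
    (hg : ∀ x y : G, gyr x y '' H = H) : IsOpenMap (CosetSpace.mk H) := by
  intro N hN
  change IsOpen (CosetSpace.mk H ⁻¹' (CosetSpace.mk H '' N))
  rw [isOpen_iff_mem_nhds]
  rintro z ⟨n, hn, hnz⟩
  obtain ⟨k, hk, rfl⟩ := exists_add_of_mk_eq hH.zero_mem hnz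
  have hc : Continuous fun y : G => y + k := by fun_prop
  filter_upwards [(hN.preimage hc).mem_nhds hn] with y hy
  exact ⟨y + k, hy, mk_add_eq hH hg y hk⟩

/-- Preimages of members of a star-countable `k`-network of `G/H` are separable when `H` is. -/
theorem exists_countable_dense_preimage_mk [IsTopologicalGyrogroup G] {H : Set G}
    (hH : IsSubgyrogroup H) (hg : ∀ x y : G, gyr x y '' H = H)
    [TopologicalSpace.SeparableSpace H] {𝒬 : Set (Set (CosetSpace H))}
    (hs : IsStarCountable 𝒬) (hk : IsKNetwork 𝒬) {P : Set (CosetSpace H)} (hP : P ∈ 𝒬) :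
    ∃ B : Set G, B.Countable ∧
      ∀ y O, CosetSpace.mk H y ∈ P → IsOpen O → y ∈ O → (B ∩ O).Nonempty := by
  obtain ⟨D, hDc, hD⟩ := TopologicalSpace.exists_countable_dense H
  have hex : ∀ Q : {Q ∈ 𝒬 | (P ∩ Q).Nonempty}, ∃ a : G, CosetSpace.mk H a ∈ P ∩ Q.1 := by
    rintro ⟨Q, -, ⟨_, a, rfl⟩, ha⟩
    exact ⟨a, ha⟩
  choose a ha using hex
  have : Countable {Q ∈ 𝒬 | (P ∩ Q).Nonempty} := (hs P hP).to_subtype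
  refine ⟨⋃ Q, (fun d : H => a Q + d) '' D, countable_iUnion fun Q => hDc.image _, ?_⟩
  intro y O hy hO hyO
  obtain ⟨ℱ, hℱ, -, hcov, hsub⟩ := hk {CosetSpace.mk H y} (CosetSpace.mk H '' O)
    isCompact_singleton (isOpenMap_mk hH hg O hO) (singleton_subset_iff.2 ⟨y, hyO, rfl⟩)
  obtain ⟨Q, hQ, hyQ⟩ := hcov rfl
  let R : {Q ∈ 𝒬 | (P ∩ Q).Nonempty} := ⟨Q, hℱ hQ, _, hy, hyQ⟩
  obtain ⟨o, ho, hoa⟩ := hsub ⟨Q, hQ, (ha R).2⟩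
  obtain ⟨k, hkH, rfl⟩ := exists_add_of_mk_eq hH.zero_mem hoa
  have hc : Continuous fun d : H => a R + d := by fun_prop
  obtain ⟨d, hd, hdD⟩ := hD.inter_open_nonempty _ (hO.preimage hc) ⟨⟨k, hkH⟩, ho⟩
  exact ⟨a R + d, mem_iUnion.2 ⟨R, d, hdD, rfl⟩, hd⟩

/-- Countably many members `V i` of the base `𝒰` control the neighborhoods of `0` in a
first-countable subset `H` through the traces of `V i + V i`. -/
theorem exists_seq_invariant_nhds [IsTopologicalGyrogroup G] {𝒰 : Set (Set G)}
    (h𝒰 : IsStrongSymmetricBase 𝒰) {H : Set G} (h0 : (0 : G) ∈ H) [FirstCountableTopology H] :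
    ∃ V : ℕ → Set G, (∀ i, V i ∈ 𝒰) ∧ ∀ O ∈ 𝓝 (0 : G), ∃ i, (V i + V i) ∩ H ⊆ O := by
  obtain ⟨A, hA⟩ := (𝓝 (⟨0, h0⟩ : H)).exists_antitone_basis
  have hex : ∀ i, ∃ V ∈ 𝒰, ∀ v ∈ V, ∀ w ∈ V, ∀ h : v + w ∈ H, (⟨v + w, h⟩ : H) ∈ A i := by
    intro i
    have hAi := hA.1.mem_of_mem (i := i) trivial
    rw [nhds_subtype, Filter.mem_comap] at hAi
    obtain ⟨T, hT, hTA⟩ := hAi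
    have hc : Filter.Tendsto (fun p : G × G => p.1 + p.2) (𝓝 0 ×ˢ 𝓝 0) (𝓝 0) := by
      have := (continuous_add (M := G)).tendsto (0, 0)
      rwa [nhds_prod_eq, add_zero] at this
    obtain ⟨V, hV, hVT⟩ := (h𝒰.hasBasis.prod_self.mem_iff).1 (hc hT)
    exact ⟨V, hV, fun v hv w hw h => hTA (hVT (mk_mem_prod hv hw))⟩
  choose V hV hVA using hex
  refine ⟨V, hV, fun O hO => ?_⟩
  have hO' : (Subtype.val ⁻¹' O : Set H) ∈ 𝓝 (⟨0, h0⟩ : H) :=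
    preimage_coe_mem_nhds_subtype.2 (mem_nhdsWithin_of_mem_nhds hO)
  obtain ⟨i, -, hi⟩ := hA.1.mem_iff.1 hO'
  refine ⟨i, ?_⟩
  rintro _ ⟨⟨v, hv, w, hw, rfl⟩, h⟩
  exact hi (hVA i v hv w hw h)

end Topological

end Gyrogroup

open Gyrogroup in
theorem mainTheorem4 {G : Type*} [TopologicalSpace G] [T2Space G] [Gyrogroup G]
    [Gyrogroup.IsTopologicalGyrogroup G]
    (𝒰 : Set (Set G)) (h𝒰 : Gyrogroup.IsStrongSymmetricBase 𝒰)
    (H : Set G) (hH : Gyrogroup.IsAdmissibleFrom 𝒰 H)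
    (hH₂ : SecondCountableTopology H)
    (hk : HasStarCountableKNetwork (Gyrogroup.CosetSpace H)) :
    HasStarCountableKNetwork G := by
  obtain ⟨𝒬, hs, hk⟩ := hk
  have hg := hH.gyr_image h𝒰
  have hH := hH.isSubgyrogroup
  have hex : ∀ P : 𝒬, _ := fun P => exists_countable_dense_preimage_mk hH hg hs hk P.2
  choose B hBc hB using hex
  obtain ⟨V, hV, hVO⟩ := exists_seq_invariant_nhds h𝒰 hH.zero_mem
  let M (P : Set (CosetSpace H)) (b : G) (i : ℕ) : Set G :=
    {z | CosetSpace.mk H z ∈ P ∧ -b + z ∈ V i}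
  let 𝒜 : Set (Set G) := {S | ∃ P : 𝒬, ∃ b ∈ B P, ∃ i, S = M P b i}
  refine ⟨𝒜, ?_, ?_⟩
  · rintro _ ⟨P, b, hb, i, rfl⟩
    have : Countable {Q ∈ 𝒬 | ((P : Set (CosetSpace H)) ∩ Q).Nonempty} := (hs P P.2).to_subtype
    refine (countable_iUnion fun Q : {Q ∈ 𝒬 | ((P : Set (CosetSpace H)) ∩ Q).Nonempty} =>
      countable_iUnion fun j : ℕ =>
        (hBc ⟨Q.1, Q.2.1⟩).image fun c => M Q.1 c j).mono ?_
    rintro _ ⟨⟨Q, c, hc, j, rfl⟩, z, hzP, hzQ⟩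
    exact mem_iUnion.2 ⟨⟨Q, Q.2, _, hzP.1, hzQ.1⟩, mem_iUnion.2 ⟨j, c, hc, rfl⟩⟩
  · intro K U hK hU hKU
    refine hK.induction_on
      (p := fun S => ∃ ℱ ⊆ 𝒜, ℱ.Finite ∧ S ⊆ ⋃₀ ℱ ∧ ⋃₀ ℱ ⊆ U) ?_ ?_ ?_ ?_
    · exact ⟨∅, empty_subset _, finite_empty, empty_subset _, by simp⟩
    · rintro S T hST ⟨ℱ, h1, h2, h3, h4⟩
      exact ⟨ℱ, h1, h2, hST.trans h3, h4⟩
    · rintro S T ⟨ℱ, h1, h2, h3, h4⟩ ⟨ℱ', h1', h2', h3', h4'⟩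
      refine ⟨ℱ ∪ ℱ', union_subset h1 h1', h2.union h2', ?_, ?_⟩
      · rw [sUnion_union]
        exact union_subset_union h3 h3'
      · rw [sUnion_union]
        exact union_subset h4 h4'
    intro x hx
    have hadd : ∀ᶠ p : G × G in 𝓝 x ×ˢ 𝓝 0, p.1 + p.2 ∈ U := by
      rw [← nhds_prod_eq]
      refine (continuous_add (M := G)).continuousAt.eventually_mem (hU.mem_nhds ?_)
      simpa using hKU hx
    obtain ⟨N₁, hN₁, O, hO, hNO⟩ := Filter.mem_prod_iff.1 hadd
    obtain ⟨i, hi⟩ := hVO O hO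
    have hsub : ∀ᶠ p : G × G in 𝓝 x ×ˢ 𝓝 x, -p.1 + p.2 ∈ V i := by
      rw [← nhds_prod_eq]
      have hc : Continuous fun p : G × G => -p.1 + p.2 := by fun_prop
      refine hc.continuousAt.eventually_mem ?_
      simp only
      rw [neg_add_self]
      exact h𝒰.hasBasis.mem_of_mem (hV i)
    obtain ⟨N₂, hN₂, hNV⟩ := Filter.mem_prod_same_iff.1 hsub
    obtain ⟨N, hN, hNo, hxN⟩ := mem_nhds_iff.1 (Filter.inter_mem hN₁ hN₂)
    -- `C = K \ W'` is a compact neighborhood of `x` in `K` contained in `N`.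
    obtain ⟨W, W', hW, hW', hxW, hKW', hdisj⟩ := SeparatedNhds.of_isCompact_isCompact
      (isCompact_singleton (x := x)) (hK.diff hNo)
      (disjoint_singleton_left.2 fun h => h.2 hxN)
    have hC : IsCompact (K \ W') := hK.diff hW'
    have hCN : K \ W' ⊆ N := fun y hy => by_contra fun h => hy.2 (hKW' ⟨hy.1, h⟩)
    refine ⟨K \ W', Filter.mem_of_superset
      (inter_mem_nhdsWithin K (hW.mem_nhds (hxW rfl)))
      fun y hy => ⟨hy.1, disjoint_left.1 hdisj hy.2⟩, ?_⟩
    obtain ⟨ℱ, hℱ, hfin, hcov, hℱN⟩ := hk _ _ (hC.image (continuous_mk H))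
      (isOpenMap_mk hH hg N hNo) (image_mono hCN)
    -- Only those `P` that lie under a point of `N` have a point of `B P` in `N`.
    have hex : ∀ P : {P ∈ ℱ | ∃ y ∈ N, CosetSpace.mk H y ∈ P},
        ∃ b, b ∈ B ⟨P.1, hℱ P.2.1⟩ ∧ b ∈ N := by
      rintro ⟨P, hP, y, hyN, hyP⟩
      exact hB ⟨P, hℱ hP⟩ y N hyP hNo hyN
    choose b hbB hbN using hex
    have : Finite {P ∈ ℱ | ∃ y ∈ N, CosetSpace.mk H y ∈ P} := (hfin.sep _).to_subtype
    refine ⟨range fun P => M P.1 (b P) i, ?_, finite_range _, ?_, ?_⟩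
    · rintro _ ⟨P, rfl⟩
      exact ⟨⟨P.1, hℱ P.2.1⟩, b P, hbB P, i, rfl⟩
    · intro y hy
      obtain ⟨P, hP, hyP⟩ := hcov (mem_image_of_mem _ hy)
      let R : {P ∈ ℱ | ∃ y ∈ N, CosetSpace.mk H y ∈ P} := ⟨P, hP, y, hCN hy, hyP⟩
      exact ⟨_, ⟨R, rfl⟩, hyP, hNV (mk_mem_prod (hN (hbN R)).2 (hN (hCN hy)).2)⟩
    · rintro z ⟨_, ⟨P, rfl⟩, hzP, hzV⟩
      exact mem_of_mk_mem_image hH.zero_mem (h𝒰.gyr_image _ (hV i))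
        (fun b hb y hy => hNV (mk_mem_prod (hN hb).2 (hN hy).2)) hi
        (fun n hn h hh => hNO (mk_mem_prod (hN hn).1 hh)) (hbN P)
        (hℱN ⟨P.1, P.2.1, hzP⟩) hzV
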